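/- **Theorem (Equivalence).** Let $\mathbb N_\infty=\mathbb N\cup\{\infty\}$, with $\min\emptyset=\infty$. A *cost register automaton* (CRA) of dimension $k$ over $(\mathbb N_\infty,\min,+)$ with finite alphabet $A$ is a deterministic finite automaton $(Q,A,\delta,q_0,F)$, $\delta\colon Q\times A\to Q$, with registers $r_1,\dots,r_k$ taking values in $\mathbb N_\infty$, together with an initial vector in $\mathbb N_\infty^k$; for each $(q,a)\in Q\times A$ constants $m_{j,i}\in\mathbb N_\infty$ ($1\le j\le k+1$, $1\le i\le k$) defining the simultaneous update $$r_i\leftarrow\min\{r_1+m_{1,i},\dots,r_k+m_{k,i},\,m_{k+1,i}\}\qquad(1\le i\le k);$$ and for each final state $q \in F$ constants $m_1,\dots,m_{k+1}\in\mathbb N_\infty$ defining the output $\min\{r_1+m_1,\dots,r_k+m_k,\,m_{k+1}\}$. The value $\mathcal C(w)\in\mathbb N_\infty$ of a CRA $\mathcal C$ on a word $w\in A^*$ is $\infty$ if the automaton rejects $w$; otherwise it is the output at the final state reached, after the registers have been initialized and then updated along the run on $w$. The CRA is *copyless* if in each of its updates, for every $i\in\{1,\dots,k\}$, at most one $j\in\{1,\dots,k\}$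 satisfies $m_{i,j}\ne\infty$. The following problem is undecidable. Given: a finite alphabet $A$ and two copyless CRA $\mathcal C$, $\mathcal C'$ over $(\mathbb N_\infty,\min,+)$ with alphabet $A$ (each given by the finite list of its data). Question: does $\mathcal C(w)=\mathcal C'(w)$ hold for all $w\in A^*$? -/

import Mathlib

/-- A cost register automaton of dimension `k` over the tropical semiring `(ℕ ∪ {∞}, min, +)`,
with alphabet `α` and state set `σ`: a deterministic complete automaton with `k` registers.
On the transition from `q` reading `a`, register `i` receives
`min {r₁ + coef q a 1 i, …, r_k + coef q a k i, const q a i}`.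
At a final state `q` the output is `min {r₁ + outCoef q 1, …, r_k + outCoef q k, outConst q}`;
`outCoef` and `outConst` are not used at the other states. -/
structure CRA (α σ : Type*) (k : ℕ) extends DFA α σ where
  init : Fin k → ℕ∞
  coef : σ → α → Fin k → Fin k → ℕ∞
  const : σ → α → Fin k → ℕ∞
  outCoef : σ → Fin k → ℕ∞
  outConst : σ → ℕ∞

namespace CRA

variable {α σ : Type*} {k : ℕ}

/-- In every update function, each register `i` contributes to at most one register `j`. -/
def Copyless (C : CRA α σ k) : Prop :=
  ∀ (q : σ) (a : α) (i : Fin k), {j : Fin k | C.coef q a i j ≠ ⊤}.encard ≤ 1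

/-- The state and register contents after reading one more letter. -/
noncomputable def next (C : CRA α σ k) (c : σ × (Fin k → ℕ∞)) (a : α) : σ × (Fin k → ℕ∞) :=
  (C.step c.1 a, fun i => min (⨅ j, (c.2 j + C.coef c.1 a j i)) (C.const c.1 a i))

/-- The state and register contents after reading a word. -/
noncomputable def run (C : CRA α σ k) (w : List α) : σ × (Fin k → ℕ∞) :=
  w.foldl C.next (C.start, C.init)

open Classical in
/-- The value computed by the machine on a word; it is `∞` on the words that the
underlying automaton rejects. -/
noncomputable def value (C : CRA α σ k) (w : List α) : ℕ∞ :=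
  if (C.run w).1 ∈ C.accept then
    min (⨅ j, ((C.run w).2 j + C.outCoef (C.run w).1 j)) (C.outConst (C.run w).1)
  else ⊤

/-- An element of `ℕ ∪ {∞}` as a finite object, `none` standing for `∞`. -/
def codeENat (m : ℕ∞) : Option ℕ := if m = ⊤ then none else some m.toNat

/-- Finite descriptions of machines: the numbers of letters, of states and of registers, the
initial state, the initial register values, for each state and letter the target state, the
coefficients and the constants of the update, and for each state its output function if the
state is final and `none` if it is not. -/
abbrev Code : Type :=
  ℕ × ℕ × ℕ × ℕ × List (Option ℕ) ×
    List (List (ℕ × List (List (Option ℕ)) × List (Option ℕ))) ×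
    List (Option (List (Option ℕ) × Option ℕ))

open Classical in
/-- The finite description of a machine with alphabet `{0, …, n - 1}` and states
`{0, …, s - 1}`. -/
noncomputable def code {n s k : ℕ} (C : CRA (Fin n) (Fin s) k) : Code :=
  (n, s, k, (C.start : ℕ),
    List.ofFn (fun i => codeENat (C.init i)),
    List.ofFn (fun q => List.ofFn (fun a =>
      ((C.step q a : ℕ),
        List.ofFn (fun i => List.ofFn (fun j => codeENat (C.coef q a i j))),
        List.ofFn (fun i => codeENat (C.const q a i))))),
    List.ofFn (fun q =>
      if q ∈ C.accept then
        some (List.ofFn (fun i => codeENat (C.outCoef q i)), codeENat (C.outConst q))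
      else none))

end CRA

/-!
The halting problem is reduced to equivalence, by way of nondeterministic programs over integer
counters (`CounterProg`). There is a partial recursive function with undecidable domain
(`exists_partrec_not_computablePred_dom`), and each partial recursive function is computed by a
counter program (`computes_of_partrec`). Here nondeterminism is convenient: unpairing and
minimization guess their result and verify it, and negative counter values do no harm, since a loop
that has missed zero can never pass its final test. Fixing one program `P` for the function, its
halting on input `v` has to be expressed by copyless cost register automata.

The runs of `P` are described by words of a regular language, so a finite automaton can control
the machine, and the registers only have to check the zero tests. Values are kept relative to a
register `base`, of value `N`: counter `j` with value `c` is represented by `pos j = N + c` and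
`neg j = N - c`, and `N` grows with each increment and decrement, so that adding `0`, `1` or `2` to
a register changes its value relative to `N` by `-1`, `0` or `1`. A further register `err` is at
most `N`, and stays equal to `N` as long as no error occurs. To test that `c = 0`, the registers
`pos j` and `neg j` are merged into `err`; this makes `err` smaller than `N` unless both are at
least `N`, and the deficit of `err` is never repaired (`base_le_err_of_act`).

The merged registers are lost, because updates are copyless, and have to be refilled from the
constant `0` with the new value of `base`. During `k` further steps `base` grows from `N` to
`N + k` and the refilled registers grow from `0` to `2 * k`, which is correct if `k = N`. Refilling
with too small a value can only make the machine report additional errors, so only `k ≤ N` needs to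
be checked. This is the purpose of the register `cap`, which is `2 * N` at the start of the test, is
kept constant meanwhile, and is finally merged into `err`; a fresh `cap` is prepared at the same
time in `spare`, which grows to `4 * k`. Upper bounds on the registers thus give soundness
(`Upper.exists_rel`), and lower bounds give completeness (`Lower.exists_word`): `P` halts on `v` if
and only if some word of the language ends with `base ≤ err` (`exists_word_iff`).

Finally, two copies of the machine with outputs `err + 1` and `min (err + 1) base` are equivalent if
and only if there is no such word (`forall_value_eq_iff`). The input `v` enters only through the
initial registers, so the descriptions of the two machines are computable from `v`.
-/

/-! ### Closure of the regular languages under concatenation and iteration -/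

namespace Language

variable {α : Type*}

/-- A language that lies in a finite family closed under quotients by single letters is regular. -/
theorem IsRegular.of_finite_closed {L : Language α} (F : Set (Language α)) (hF : F.Finite)
    (hL : L ∈ F) (hstep : ∀ K ∈ F, ∀ a, K.leftQuotient [a] ∈ F) : L.IsRegular := by
  refine .of_finite_range_leftQuotient (hF.subset ?_)
  rintro _ ⟨x, rfl⟩
  induction x using List.reverseRecOn with
  | nil => exact hL
  | append_singleton x a ih => rw [leftQuotient_append]; exact hstep _ ih a

theorem leftQuotient_mem_range {L K : Language α} (h : K ∈ Set.range L.leftQuotient) (a : α) :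
    K.leftQuotient [a] ∈ Set.range L.leftQuotient := by
  obtain ⟨x, rfl⟩ := h
  exact ⟨x ++ [a], leftQuotient_append ..⟩

theorem isRegular_singleton (a : α) : IsRegular ({[a]} : Language α) := by
  refine .of_finite_closed {{[a]}, {[]}, 0} (by simp) (by simp) ?_
  rintro K (rfl | rfl | rfl) b
  · by_cases h : a = b
    · refine .inr (.inl ?_)
      ext x
      change [b] ++ x = [a] ↔ x = []
      simp [h]
    · refine .inr (.inr ?_)
      ext x
      change [b] ++ x = [a] ↔ False
      simp [Ne.symm h]
  · refine .inr (.inr ?_)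
    ext x
    change [b] ++ x = [] ↔ False
    simp
  · exact .inr (.inr rfl)

theorem cons_mem_mul {A M : Language α} {a : α} {x : List α} :
    a :: x ∈ A * M ↔ x ∈ A.leftQuotient [a] * M ∨ [] ∈ A ∧ a :: x ∈ M := by
  constructor
  · rintro ⟨u, hu, v, hv, huv⟩
    cases u with
    | nil => exact .inr ⟨hu, by rw [← huv]; exact hv⟩
    | cons b u =>
      obtain ⟨rfl, rfl⟩ : b = a ∧ u ++ v = x := by simpa using huv
      exact .inl ⟨u, hu, v, hv, rfl⟩
  · rintro (⟨u, hu, v, hv, rfl⟩ | ⟨h, hx⟩)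
    · exact ⟨a :: u, hu, v, hv, rfl⟩
    · exact ⟨[], h, _, hx, rfl⟩

theorem cons_mem_kstar {L : Language α} {a : α} {x : List α} :
    a :: x ∈ KStar.kstar L ↔ x ∈ L.leftQuotient [a] * KStar.kstar L := by
  constructor
  · intro hx
    obtain ⟨S, hS, h⟩ : ∃ S : List (List α), a :: x = S.flatten ∧ ∀ y ∈ S, y ∈ L ∧ y ≠ [] := by
      rwa [kstar_def_nonempty] at hx
    cases S with
    | nil => simp at hS
    | cons u S =>
      obtain ⟨hu, hu'⟩ := h u (by simp)
      cases u with
      | nil => exact absurd rfl hu'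
      | cons b u =>
        obtain ⟨rfl, rfl⟩ : a = b ∧ x = u ++ S.flatten := by simpa using hS
        exact ⟨u, hu, _, join_mem_kstar fun y hy => (h y (List.mem_cons_of_mem _ hy)).1, rfl⟩
  · rintro ⟨u, hu, v, hv, rfl⟩
    rw [← one_add_self_mul_kstar_eq_kstar]
    exact .inr ⟨a :: u, hu, v, hv, rfl⟩

theorem IsRegular.mul {L M : Language α} (hL : L.IsRegular) (hM : M.IsRegular) :
    (L * M).IsRegular := by
  -- the quotients of `L * M` are sums of some `A * M` and of quotients of `M`
  refine .of_finite_closed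
    ((fun p : Language α × Set (Language α) => {x | x ∈ p.1 * M ∨ ∃ B ∈ p.2, x ∈ B}) ''
      (Set.range L.leftQuotient ×ˢ 𝒫 (Set.range M.leftQuotient)))
    ((hL.finite_range_leftQuotient.prod hM.finite_range_leftQuotient.powerset).image _)
    ⟨(L, ∅), ⟨⟨[], rfl⟩, Set.empty_subset _⟩, ?_⟩ ?_
  · ext x
    change (x ∈ L * M ∨ ∃ B ∈ (∅ : Set (Language α)), x ∈ B) ↔ _
    simp
  · rintro _ ⟨⟨A, S⟩, ⟨hA, hS⟩, rfl⟩ a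
    refine ⟨(A.leftQuotient [a],
      (fun B : Language α => B.leftQuotient [a]) '' S ∪
        {B | [] ∈ A ∧ B = M.leftQuotient [a]}), ⟨leftQuotient_mem_range hA a, ?_⟩, ?_⟩
    · rintro _ (⟨B, hB, rfl⟩ | ⟨-, rfl⟩)
      · exact leftQuotient_mem_range (hS hB) a
      · exact ⟨[a], rfl⟩
    · ext x
      change (x ∈ A.leftQuotient [a] * M ∨
        ∃ B ∈ ((fun B : Language α => B.leftQuotient [a]) '' S ∪
          {B | [] ∈ A ∧ B = M.leftQuotient [a]} : Set (Language α)), x ∈ B) ↔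
        (a :: x ∈ A * M ∨ ∃ B ∈ S, a :: x ∈ B)
      rw [cons_mem_mul, or_assoc]
      refine or_congr_right ⟨?_, ?_⟩
      · rintro ⟨_, ⟨B, hB, rfl⟩ | ⟨h, rfl⟩, hx⟩
        · exact .inr ⟨B, hB, hx⟩
        · exact .inl ⟨h, hx⟩
      · rintro (⟨h, hx⟩ | ⟨B, hB, hx⟩)
        · exact ⟨_, .inr ⟨h, rfl⟩, hx⟩
        · exact ⟨_, .inl ⟨B, hB, rfl⟩, hx⟩

theorem IsRegular.kstar {L : Language α} (hL : L.IsRegular) :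
    (KStar.kstar L).IsRegular := by
  -- the quotients of `L∗` other than `L∗` are sums of languages `A * L∗`, with `A` a quotient of `L`
  refine .of_finite_closed
    (insert (KStar.kstar L)
      ((fun S : Set (Language α) => {x | ∃ A ∈ S, x ∈ A * KStar.kstar L}) ''
        𝒫 (Set.range L.leftQuotient)))
    ((hL.finite_range_leftQuotient.powerset.image _).insert _) (.inl rfl) ?_
  rintro _ (rfl | ⟨S, hS, rfl⟩) a
  · refine .inr ⟨{L.leftQuotient [a]}, by rintro _ rfl; exact ⟨[a], rfl⟩, ?_⟩
    ext x
    change (∃ A ∈ ({L.leftQuotient [a]} : Set (Language α)), x ∈ A * KStar.kstar L) ↔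
      a :: x ∈ KStar.kstar L
    rw [cons_mem_kstar]
    simp
  · refine .inr ⟨(fun A : Language α => A.leftQuotient [a]) '' S ∪
        {B | (∃ A ∈ S, [] ∈ A) ∧ B = L.leftQuotient [a]}, ?_, ?_⟩
    · rintro _ (⟨B, hB, rfl⟩ | ⟨-, rfl⟩)
      · exact leftQuotient_mem_range (hS hB) a
      · exact ⟨[a], rfl⟩
    · ext x
      change (∃ B ∈ ((fun A : Language α => A.leftQuotient [a]) '' S ∪
        {B | (∃ A ∈ S, [] ∈ A) ∧ B = L.leftQuotient [a]} : Set (Language α)),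
          x ∈ B * KStar.kstar L) ↔ (∃ A ∈ S, a :: x ∈ A * KStar.kstar L)
      constructor
      · rintro ⟨_, ⟨A, hA, rfl⟩ | ⟨⟨A, hA, h⟩, rfl⟩, hx⟩
        · exact ⟨A, hA, cons_mem_mul.2 (.inl hx)⟩
        · exact ⟨A, hA, cons_mem_mul.2 (.inr ⟨h, cons_mem_kstar.2 hx⟩)⟩
      · rintro ⟨A, hA, hx⟩
        rcases cons_mem_mul.1 hx with hx | ⟨h, hx⟩
        · exact ⟨_, .inl ⟨A, hA, rfl⟩, hx⟩
        · exact ⟨_, .inr ⟨⟨A, hA, h⟩, rfl⟩, cons_mem_kstar.1 hx⟩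

end Language

/-! ### Nondeterministic counter programs -/

/-- Nondeterministic programs over counters `0, 1, 2, …` with values in `ℤ`. The program `zero i`
blocks unless counter `i` is zero; `alt` and `star` choose their branch, respectively their number
of iterations, nondeterministically. -/
inductive CounterProg : Type
  | inc (i : ℕ) : CounterProg
  | dec (i : ℕ) : CounterProg
  | zero (i : ℕ) : CounterProg
  | seq (P Q : CounterProg) : CounterProg
  | alt (P Q : CounterProg) : CounterProg
  | star (P : CounterProg) : CounterProg

namespace CounterProg

/-- `P.rel s s'` says that `P` can lead from the counter values `s` to `s'`. -/
def rel : CounterProg → (ℕ → ℤ) → (ℕ → ℤ) → Prop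
  | inc i => fun s s' => s' = Function.update s i (s i + 1)
  | dec i => fun s s' => s' = Function.update s i (s i - 1)
  | zero i => fun s s' => s i = 0 ∧ s' = s
  | seq P Q => fun s s' => ∃ t, P.rel s t ∧ Q.rel t s'
  | alt P Q => fun s s' => P.rel s s' ∨ Q.rel s s'
  | star P => Relation.ReflTransGen P.rel

/-- An upper bound on the indices of the counters that occur in a program. -/
def bound : CounterProg → ℕ
  | inc i => i
  | dec i => i
  | zero i => i
  | seq P Q => max P.bound Q.bound
  | alt P Q => max P.bound Q.bound
  | star P => P.bound

end CounterProg

/-! ### A min-plus register machine that checks counter programs -/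

namespace CounterProg

/-- The letters of the machine for the counters `0, …, m`. The words `test i, grow i, …, grow i,
close` implement the test whether counter `i` is zero. -/
inductive Letter (m : ℕ) : Type
  | inc (i : Fin (m + 1)) : Letter m
  | dec (i : Fin (m + 1)) : Letter m
  | test (i : Fin (m + 1)) : Letter m
  | grow (i : Fin (m + 1)) : Letter m
  | close : Letter m
  deriving Fintype

/-- The registers. On a word without errors, if `base` is `N` and counter `j` is `c`, then `err` is
`N`, `pos j` is `N + c`, `neg j` is `N - c` and `cap` is `2 * N`. The register `spare` is the next
`cap` while it is being refilled. -/
inductive Reg (m : ℕ) : Type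
  | base : Reg m
  | err : Reg m
  | pos (j : Fin (m + 1)) : Reg m
  | neg (j : Fin (m + 1)) : Reg m
  | cap : Reg m
  | spare : Reg m
  deriving Fintype

variable {m : ℕ}

/-- The only register to which register `x` contributes in the update for a letter. -/
def target : Letter m → Reg m → Reg m
  | .test i, .pos j => if j = i then .err else .pos j
  | .test i, .neg j => if j = i then .err else .neg j
  | .close, .cap => .err
  | .close, .spare => .cap
  | _, x => x

/-- The number added to the contribution of register `x` in the update for a letter. -/
def delta : Letter m → Reg m → ℕ
  | .inc _, .base => 1
  | .inc _, .err => 1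
  | .inc i, .pos j => if j = i then 2 else 1
  | .inc i, .neg j => if j = i then 0 else 1
  | .inc _, .cap => 2
  | .dec _, .base => 1
  | .dec _, .err => 1
  | .dec i, .pos j => if j = i then 0 else 1
  | .dec i, .neg j => if j = i then 2 else 1
  | .dec _, .cap => 2
  | .grow _, .base => 1
  | .grow _, .err => 1
  | .grow i, .pos j => if j = i then 2 else 1
  | .grow i, .neg j => if j = i then 2 else 1
  | .grow _, .spare => 4
  | _, _ => 0

/-- The registers that receive the constant `0` in the update for a letter. -/
def fresh : Letter m → Set (Reg m)
  | .test i => {.pos i, .neg i, .spare}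
  | _ => ∅

open Classical in
/-- The coefficient with which register `x` contributes to register `y`. -/
noncomputable def weight (a : Letter m) (x y : Reg m) : ℕ∞ :=
  if target a x = y then delta a x else ⊤

open Classical in
/-- The constant in the update of register `y`. -/
noncomputable def reset (a : Letter m) (y : Reg m) : ℕ∞ :=
  if y ∈ fresh a then 0 else ⊤

/-- The update of the register contents for a letter. -/
noncomputable def act (r : Reg m → ℕ∞) (a : Letter m) : Reg m → ℕ∞ :=
  fun y => min (⨅ x, (r x + weight a x y)) (reset a y)

/-- `x ≤ t`, for an integer `t`; false if `t` is negative. -/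
def AtMost (x : ℕ∞) (t : ℤ) : Prop := 0 ≤ t ∧ x ≤ (t.toNat : ℕ∞)

/-- `t ≤ x`, for an integer `t`. The truncation in `Int.toNat` is harmless, since `0 ≤ x`. -/
def AtLeast (x : ℕ∞) (t : ℤ) : Prop := (t.toNat : ℕ∞) ≤ x

theorem AtLeast.le_of_atMost {x y : ℕ∞} {s t : ℤ} (h : AtLeast x s) (hxy : x ≤ y)
    (h' : AtMost y t) : s ≤ t := by
  have := (h.trans hxy).trans h'.2
  have h0 := h'.1
  rw [Nat.cast_le] at this
  omega

theorem AtLeast.mono {x : ℕ∞} {s t : ℤ} (h : AtLeast x s) (hst : t ≤ s) : AtLeast x t :=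
  le_trans (by gcongr; omega) h

/-- Upper bounds propagate along each single contribution to an update. -/
theorem atMost_act {r : Reg m → ℕ∞} {a : Letter m} (x : Reg m) {y : Reg m} {s t : ℤ}
    (h : AtMost (r x) s) (hy : target a x = y) (ht : s + delta a x ≤ t) :
    AtMost (act r a y) t := by
  have h0 := h.1
  refine ⟨by omega, (min_le_left _ _).trans ((iInf_le _ x).trans ?_)⟩
  rw [weight, if_pos hy]
  refine (add_le_add_left h.2 _).trans ?_
  norm_cast
  omega

theorem atMost_act_of_fresh (r : Reg m → ℕ∞) {a : Letter m} {y : Reg m} (hy : y ∈ fresh a) :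
    AtMost (act r a y) 0 := by
  refine ⟨le_rfl, (min_le_right _ _).trans ?_⟩
  rw [reset, if_pos hy]
  simp

/-- Lower bounds have to hold for all contributions to an update. -/
theorem atLeast_act {r : Reg m → ℕ∞} {a : Letter m} {y : Reg m} {t : ℤ}
    (h : ∀ x, target a x = y → AtLeast (r x) (t - delta a x)) (hy : y ∈ fresh a → t ≤ 0) :
    AtLeast (act r a y) t := by
  refine le_min (le_iInf fun x => ?_) ?_
  · rw [weight]
    split_ifs with hx
    · refine le_trans ?_ (add_le_add_left (h x hx) _)
      norm_cast
      omega
    · simp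
  · rw [reset]
    split_ifs with h0
    · have := hy h0
      simp [Int.toNat_of_nonpos this]
    · simp

theorem act_base (r : Reg m → ℕ∞) (a : Letter m) : act r a .base = r .base + delta a .base := by
  have ht : ∀ x, target a x = .base ↔ x = .base := by
    intro x
    cases a <;> cases x <;> simp only [target] <;> (try split_ifs) <;> simp
  have hf : Reg.base ∉ fresh a := by cases a <;> simp [fresh]
  simp only [act, weight, reset, hf, if_false, le_top, inf_of_le_left]
  refine le_antisymm ((iInf_le _ .base).trans (by simp [(ht _).2 rfl])) (le_iInf fun x => ?_)
  split_ifs with hx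
  · rw [(ht x).1 hx]
  · simp

/-- The defect of `err` with respect to `base` cannot be repaired. -/
theorem base_le_err_of_act {r : Reg m → ℕ∞} {a : Letter m}
    (h : act r a .base ≤ act r a .err) : r .base ≤ r .err := by
  have ht : target a .err = .err := by cases a <;> rfl
  have hd : delta a .err = delta a .base := by cases a <;> rfl
  have h' : act r a .err ≤ r .err + delta a .base :=
    (min_le_left _ _).trans ((iInf_le _ .err).trans (by simp [weight, ht, hd]))
  rw [act_base] at h
  exact (ENat.add_le_add_iff_right (ENat.natCast_ne_top _)).1 (h.trans h')

theorem base_le_err_of_foldl {r : Reg m → ℕ∞} {w : List (Letter m)}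
    (h : w.foldl act r .base ≤ w.foldl act r .err) : r .base ≤ r .err := by
  induction w generalizing r with
  | nil => exact h
  | cons a w ih => exact base_le_err_of_act (ih h)

/-- The words over the letters of the machine that implement the runs of a program. -/
def language (m : ℕ) : CounterProg → Language (Letter m)
  | inc i => {[.inc (Fin.ofNat (m + 1) i)]}
  | dec i => {[.dec (Fin.ofNat (m + 1) i)]}
  | zero i => {[.test (Fin.ofNat (m + 1) i)]} *
      (KStar.kstar {[.grow (Fin.ofNat (m + 1) i)]} * {[.close]})
  | seq P Q => P.language m * Q.language m
  | alt P Q => P.language m + Q.language m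
  | star P => KStar.kstar (P.language m)

theorem isRegular_language (P : CounterProg) : (P.language m).IsRegular := by
  induction P with
  | inc i => exact Language.isRegular_singleton _
  | dec i => exact Language.isRegular_singleton _
  | zero i =>
    exact (Language.isRegular_singleton _).mul
      ((Language.isRegular_singleton _).kstar.mul (Language.isRegular_singleton _))
  | seq P Q hP hQ => exact hP.mul hQ
  | alt P Q hP hQ => exact hP.add hQ
  | star P hP => exact hP.kstar

theorem replicate_mem_kstar {α : Type*} (a : α) (k : ℕ) :
    List.replicate k a ∈ KStar.kstar ({[a]} : Language α) :=
  Language.mem_kstar.2 ⟨List.replicate k [a], by simp, fun _ hy => List.eq_of_mem_replicate hy⟩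

theorem eq_replicate_of_mem_kstar {α : Type*} {a : α} {w : List α}
    (h : w ∈ KStar.kstar ({[a]} : Language α)) : ∃ k, w = List.replicate k a := by
  obtain ⟨S, rfl, hS⟩ := Language.mem_kstar.1 h
  refine ⟨S.length, ?_⟩
  rw [List.eq_replicate_of_mem hS]
  simp

theorem mem_language_zero {i : ℕ} {w : List (Letter m)} :
    w ∈ (zero i).language m ↔ ∃ k, w = .test (Fin.ofNat (m + 1) i) ::
      (List.replicate k (.grow (Fin.ofNat (m + 1) i)) ++ [.close]) := by
  constructor
  · rintro ⟨_, rfl, _, ⟨u, hu, _, rfl, rfl⟩, rfl⟩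
    obtain ⟨k, rfl⟩ := eq_replicate_of_mem_kstar hu
    exact ⟨k, rfl⟩
  · rintro ⟨k, rfl⟩
    exact ⟨_, rfl, _, ⟨_, replicate_mem_kstar _ k, _, rfl, rfl⟩, rfl⟩

theorem act_foldl_replicate (r : Reg m → ℕ∞) (a : Letter m) (k : ℕ) :
    (List.replicate (k + 1) a).foldl act r = act ((List.replicate k a).foldl act r) a := by
  rw [List.replicate_succ', List.foldl_append]
  rfl

/-! ### Soundness of the machine -/

/-- The register contents are at most what they should be, for the counter values `c`, relative to
a value of `base` that is at least `N`. -/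
structure Upper (N : ℤ) (c : ℕ → ℤ) (r : Reg m → ℕ∞) : Prop where
  base : AtLeast (r .base) N
  pos : ∀ j : Fin (m + 1), AtMost (r (.pos j)) (N + c j)
  neg : ∀ j : Fin (m + 1), AtMost (r (.neg j)) (N - c j)
  cap : AtMost (r .cap) (2 * N)

/-- The analogue of `Upper` inside a test of counter `i`, when `base` has grown from `N` by `k`. -/
structure UpperTest (i : Fin (m + 1)) (N k : ℤ) (c : ℕ → ℤ) (r : Reg m → ℕ∞) : Prop where
  base : AtLeast (r .base) (N + k)
  pos : ∀ j, j ≠ i → AtMost (r (.pos j)) (N + k + c j)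
  neg : ∀ j, j ≠ i → AtMost (r (.neg j)) (N + k - c j)
  pos_self : AtMost (r (.pos i)) (2 * k)
  neg_self : AtMost (r (.neg i)) (2 * k)
  cap : AtMost (r .cap) (2 * N)
  spare : AtMost (r .spare) (4 * k)

section Sound

variable {N k : ℤ} {c : ℕ → ℤ} {r : Reg m → ℕ∞} {i : Fin (m + 1)}

theorem atLeast_act_base {a : Letter m} {t : ℤ} (h : AtLeast (r .base) (t - delta a .base)) :
    AtLeast (act r a .base) t := by
  rw [AtLeast, act_base]
  refine le_trans ?_ (add_le_add_left h _)
  norm_cast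
  omega

theorem Upper.inc (h : Upper N c r) :
    Upper (N + 1) (Function.update c i (c i + 1)) (act r (.inc i)) where
  base := atLeast_act_base (by simpa [delta] using h.base)
  pos j := by
    refine atMost_act _ (h.pos j) rfl ?_
    simp only [Function.update_apply, delta, ← Fin.ext_iff]
    split_ifs with hj
    · subst hj; push_cast; omega
    · push_cast; omega
  neg j := by
    refine atMost_act _ (h.neg j) rfl ?_
    simp only [Function.update_apply, delta, ← Fin.ext_iff]
    split_ifs with hj
    · subst hj; push_cast; omega
    · push_cast; omega
  cap := atMost_act _ h.cap rfl (by simp only [delta]; push_cast; omega)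

theorem Upper.dec (h : Upper N c r) :
    Upper (N + 1) (Function.update c i (c i - 1)) (act r (.dec i)) where
  base := atLeast_act_base (by simpa [delta] using h.base)
  pos j := by
    refine atMost_act _ (h.pos j) rfl ?_
    simp only [Function.update_apply, delta, ← Fin.ext_iff]
    split_ifs with hj
    · subst hj; push_cast; omega
    · push_cast; omega
  neg j := by
    refine atMost_act _ (h.neg j) rfl ?_
    simp only [Function.update_apply, delta, ← Fin.ext_iff]
    split_ifs with hj
    · subst hj; push_cast; omega
    · push_cast; omega
  cap := atMost_act _ h.cap rfl (by simp only [delta]; push_cast; omega)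

theorem Upper.test (h : Upper N c r) (he : act r (.test i) .base ≤ act r (.test i) .err) :
    c i = 0 ∧ UpperTest i N 0 c (act r (.test i)) := by
  have hb : AtLeast (act r (.test i) .base) N := atLeast_act_base (by simpa [delta] using h.base)
  have h1 := hb.le_of_atMost he (atMost_act _ (h.pos i) (by simp [target]) le_rfl)
  have h2 := hb.le_of_atMost he (atMost_act _ (h.neg i) (by simp [target]) le_rfl)
  simp only [delta] at h1 h2
  push_cast at h1 h2
  refine ⟨by omega, by simpa using hb, fun j hj => ?_, fun j hj => ?_,
    atMost_act_of_fresh _ (by simp [fresh]), atMost_act_of_fresh _ (by simp [fresh]), ?_,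
    atMost_act_of_fresh _ (by simp [fresh])⟩
  · exact atMost_act _ (h.pos j) (by simp [target, hj]) (by simp [delta])
  · exact atMost_act _ (h.neg j) (by simp [target, hj]) (by simp [delta])
  · exact atMost_act _ h.cap rfl (by simp [delta])

theorem UpperTest.grow (h : UpperTest i N k c r) : UpperTest i N (k + 1) c (act r (.grow i)) where
  base := atLeast_act_base (h.base.mono (by simp only [delta]; push_cast; omega))
  pos j hj := atMost_act _ (h.pos j hj) rfl (by simp only [delta, hj, if_false]; push_cast; omega)
  neg j hj := atMost_act _ (h.neg j hj) rfl (by simp only [delta, hj, if_false]; push_cast; omega)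
  pos_self := atMost_act _ h.pos_self rfl (by simp only [delta, if_true]; push_cast; omega)
  neg_self := atMost_act _ h.neg_self rfl (by simp only [delta, if_true]; push_cast; omega)
  cap := atMost_act _ h.cap rfl (by simp [delta])
  spare := atMost_act _ h.spare rfl (by simp only [delta]; push_cast; omega)

theorem UpperTest.close (h : UpperTest i N k c r) (hc : c i = 0)
    (he : act r .close .base ≤ act r .close .err) : Upper (N + k) c (act r .close) := by
  have hb : AtLeast (act r .close .base) (N + k) :=
    atLeast_act_base (by simpa [delta] using h.base)
  -- the old `cap` bounds the number `k` of growing steps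
  have hk := hb.le_of_atMost he (atMost_act _ h.cap rfl le_rfl)
  simp only [delta] at hk
  push_cast at hk
  refine ⟨hb, fun j => ?_, fun j => ?_, ?_⟩
  · by_cases hj : j = i
    · subst hj
      exact atMost_act _ h.pos_self rfl (by simp only [delta]; push_cast; omega)
    · exact atMost_act _ (h.pos j hj) rfl (by simp [delta])
  · by_cases hj : j = i
    · subst hj
      exact atMost_act _ h.neg_self rfl (by simp only [delta]; push_cast; omega)
    · exact atMost_act _ (h.neg j hj) rfl (by simp [delta])
  · exact atMost_act _ h.spare rfl (by simp only [delta]; push_cast; omega)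

end Sound

theorem val_ofNat_of_le {i : ℕ} (h : i ≤ m) : (Fin.ofNat (m + 1) i : ℕ) = i := by
  simp only [Fin.ofNat]
  exact Nat.mod_eq_of_lt (by omega)

theorem Upper.zero {N : ℤ} {c : ℕ → ℤ} {r : Reg m → ℕ∞} {i : ℕ} (hi : i ≤ m)
    {w : List (Letter m)} (hw : w ∈ (CounterProg.zero i).language m) (h : Upper N c r)
    (he : w.foldl act r .base ≤ w.foldl act r .err) :
    c i = 0 ∧ ∃ N', Upper N' c (w.foldl act r) := by
  obtain ⟨k, rfl⟩ := mem_language_zero.1 hw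
  obtain ⟨h0, h1⟩ := h.test (base_le_err_of_foldl he)
  have h2 : ∀ k : ℕ, UpperTest (Fin.ofNat (m + 1) i) N k c
      ((List.replicate k (.grow (Fin.ofNat (m + 1) i))).foldl act
        (act r (.test (Fin.ofNat (m + 1) i)))) := by
    intro k
    induction k with
    | zero => exact h1
    | succ k ih =>
      rw [act_foldl_replicate]
      exact_mod_cast ih.grow
  rw [List.foldl_cons, List.foldl_append] at he ⊢
  refine ⟨by rwa [val_ofNat_of_le hi] at h0, _, (h2 k).close h0 he⟩

/-- A word of the language of `P` that ends with `base ≤ err` describes a run of `P`. -/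
theorem Upper.exists_rel {P : CounterProg} (hP : P.bound ≤ m) {w : List (Letter m)}
    (hw : w ∈ P.language m) {N : ℤ} {c : ℕ → ℤ} {r : Reg m → ℕ∞} (h : Upper N c r)
    (he : w.foldl act r .base ≤ w.foldl act r .err) :
    ∃ N' c', P.rel c c' ∧ Upper N' c' (w.foldl act r) := by
  induction P generalizing w N c r with
  | inc i =>
    obtain rfl := hw
    have := h.inc (i := Fin.ofNat (m + 1) i)
    rw [val_ofNat_of_le (i := i) hP] at this
    exact ⟨_, _, rfl, this⟩
  | dec i =>
    obtain rfl := hw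
    have := h.dec (i := Fin.ofNat (m + 1) i)
    rw [val_ofNat_of_le (i := i) hP] at this
    exact ⟨_, _, rfl, this⟩
  | zero i =>
    obtain ⟨h0, N', h'⟩ := h.zero hP hw he
    exact ⟨N', c, ⟨h0, rfl⟩, h'⟩
  | seq P Q ihP ihQ =>
    obtain ⟨u, hu, v, hv, rfl⟩ := hw
    simp only [List.foldl_append] at he ⊢
    obtain ⟨N1, c1, hr1, h1⟩ :=
      ihP ((le_max_left _ _).trans hP) hu h (base_le_err_of_foldl he)
    obtain ⟨N2, c2, hr2, h2⟩ := ihQ ((le_max_right _ _).trans hP) hv h1 he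
    exact ⟨N2, c2, ⟨c1, hr1, hr2⟩, h2⟩
  | alt P Q ihP ihQ =>
    rcases hw with hw | hw
    · obtain ⟨N', c', hr, h'⟩ := ihP ((le_max_left _ _).trans hP) hw h he
      exact ⟨N', c', .inl hr, h'⟩
    · obtain ⟨N', c', hr, h'⟩ := ihQ ((le_max_right _ _).trans hP) hw h he
      exact ⟨N', c', .inr hr, h'⟩
  | star P ih =>
    obtain ⟨S, rfl, hS⟩ := Language.mem_kstar.1 hw
    clear hw
    induction S generalizing N c r with
    | nil => exact ⟨N, c, .refl, h⟩
    | cons u S ihS =>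
      simp only [List.flatten_cons, List.foldl_append] at he ⊢
      obtain ⟨N1, c1, hr1, h1⟩ := ih hP (hS u (by simp)) h (base_le_err_of_foldl he)
      obtain ⟨N2, c2, hr2, h2⟩ := ihS h1 (fun y hy => hS y (List.mem_cons_of_mem _ hy)) he
      exact ⟨N2, c2, .head hr1 hr2, h2⟩

/-! ### Completeness of the machine -/

/-- The register contents are at least what they should be, for the counter values `c`, relative to
a value of `base` that is at most `N`. -/
structure Lower (N : ℤ) (c : ℕ → ℤ) (r : Reg m → ℕ∞) : Prop where
  base : AtMost (r .base) N
  err : AtLeast (r .err) N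
  pos : ∀ j : Fin (m + 1), AtLeast (r (.pos j)) (N + c j)
  neg : ∀ j : Fin (m + 1), AtLeast (r (.neg j)) (N - c j)
  cap : AtLeast (r .cap) (2 * N)

/-- The analogue of `Lower` inside a test of counter `i`, when `base` has grown from `N` by `k`. -/
structure LowerTest (i : Fin (m + 1)) (N k : ℤ) (c : ℕ → ℤ) (r : Reg m → ℕ∞) : Prop where
  base : AtMost (r .base) (N + k)
  err : AtLeast (r .err) (N + k)
  pos : ∀ j, j ≠ i → AtLeast (r (.pos j)) (N + k + c j)
  neg : ∀ j, j ≠ i → AtLeast (r (.neg j)) (N + k - c j)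
  pos_self : AtLeast (r (.pos i)) (2 * k)
  neg_self : AtLeast (r (.neg i)) (2 * k)
  cap : AtLeast (r .cap) (2 * N)
  spare : AtLeast (r .spare) (4 * k)

section Complete

variable {N k : ℤ} {c : ℕ → ℤ} {r : Reg m → ℕ∞} {i : Fin (m + 1)}

theorem atMost_act_base {a : Letter m} {t : ℤ} (h : AtMost (r .base) (t - delta a .base)) :
    AtMost (act r a .base) t :=
  atMost_act .base h (by cases a <;> rfl) (by omega)

/-- If only register `y` contributes to register `y`, a single lower bound is enough. -/
theorem atLeast_act_of_target {a : Letter m} {y : Reg m} {s t : ℤ} (h : AtLeast (r y) s)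
    (ht : ∀ x, target a x = y → x = y) (hy : y ∉ fresh a) (hst : t ≤ s + delta a y) :
    AtLeast (act r a y) t := by
  refine atLeast_act (fun x hx => ?_) fun h0 => absurd h0 hy
  obtain rfl := ht x hx
  exact h.mono (by omega)

theorem target_inc (x : Reg m) : target (.inc i) x = x := by cases x <;> rfl

theorem target_dec (x : Reg m) : target (.dec i) x = x := by cases x <;> rfl

theorem target_grow (x : Reg m) : target (.grow i) x = x := by cases x <;> rfl

theorem Lower.inc (h : Lower N c r) :
    Lower (N + 1) (Function.update c i (c i + 1)) (act r (.inc i)) where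
  base := atMost_act_base (by simpa [delta] using h.base)
  err := atLeast_act_of_target h.err (by simp [target_inc]) (by simp [fresh])
    (by simp only [delta]; push_cast; omega)
  pos j := by
    refine atLeast_act_of_target (h.pos j) (by simp [target_inc]) (by simp [fresh]) ?_
    simp only [Function.update_apply, delta, ← Fin.ext_iff]
    split_ifs with hj
    · subst hj; push_cast; omega
    · push_cast; omega
  neg j := by
    refine atLeast_act_of_target (h.neg j) (by simp [target_inc]) (by simp [fresh]) ?_
    simp only [Function.update_apply, delta, ← Fin.ext_iff]
    split_ifs with hj
    · subst hj; push_cast; omega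
    · push_cast; omega
  cap := atLeast_act_of_target h.cap (by simp [target_inc]) (by simp [fresh])
    (by simp only [delta]; push_cast; omega)

theorem Lower.dec (h : Lower N c r) :
    Lower (N + 1) (Function.update c i (c i - 1)) (act r (.dec i)) where
  base := atMost_act_base (by simpa [delta] using h.base)
  err := atLeast_act_of_target h.err (by simp [target_dec]) (by simp [fresh])
    (by simp only [delta]; push_cast; omega)
  pos j := by
    refine atLeast_act_of_target (h.pos j) (by simp [target_dec]) (by simp [fresh]) ?_
    simp only [Function.update_apply, delta, ← Fin.ext_iff]
    split_ifs with hj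
    · subst hj; push_cast; omega
    · push_cast; omega
  neg j := by
    refine atLeast_act_of_target (h.neg j) (by simp [target_dec]) (by simp [fresh]) ?_
    simp only [Function.update_apply, delta, ← Fin.ext_iff]
    split_ifs with hj
    · subst hj; push_cast; omega
    · push_cast; omega
  cap := atLeast_act_of_target h.cap (by simp [target_dec]) (by simp [fresh])
    (by simp only [delta]; push_cast; omega)

theorem Lower.test (h : Lower N c r) (hc : c i = 0) :
    LowerTest i N 0 c (act r (.test i)) where
  base := atMost_act_base (by simpa [delta] using h.base)
  err := by
    have h1 := h.pos i
    have h2 := h.neg i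
    rw [hc] at h1 h2
    refine atLeast_act (fun x hx => ?_) (by simp [fresh])
    cases x with
    | err => simpa [delta] using h.err
    | pos j =>
      obtain rfl : j = i := by
        by_contra hj
        simp [target, hj] at hx
      simpa [delta] using h1
    | neg j =>
      obtain rfl : j = i := by
        by_contra hj
        simp [target, hj] at hx
      simpa [delta] using h2
    | _ => simp [target] at hx
  pos j hj := by
    refine atLeast_act_of_target (h.pos j) (fun x => ?_) (by simp [fresh, hj]) (by simp [delta])
    cases x <;> simp only [target] <;> (try split_ifs) <;> simp
  neg j hj := by
    refine atLeast_act_of_target (h.neg j) (fun x => ?_) (by simp [fresh, hj]) (by simp [delta])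
    cases x <;> simp only [target] <;> (try split_ifs) <;> simp
  pos_self := by simp [AtLeast]
  neg_self := by simp [AtLeast]
  cap := by
    refine atLeast_act_of_target h.cap (fun x => ?_) (by simp [fresh]) (by simp [delta])
    cases x <;> simp only [target] <;> (try split_ifs) <;> simp
  spare := by simp [AtLeast]

theorem LowerTest.grow (h : LowerTest i N k c r) : LowerTest i N (k + 1) c (act r (.grow i)) where
  base := atMost_act_base (by simpa [delta, ← add_assoc] using h.base)
  err := atLeast_act_of_target h.err (by simp [target_grow]) (by simp [fresh])
    (by simp only [delta]; push_cast; omega)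
  pos j hj := atLeast_act_of_target (h.pos j hj) (by simp [target_grow]) (by simp [fresh])
    (by simp only [delta, hj, if_false]; push_cast; omega)
  neg j hj := atLeast_act_of_target (h.neg j hj) (by simp [target_grow]) (by simp [fresh])
    (by simp only [delta, hj, if_false]; push_cast; omega)
  pos_self := atLeast_act_of_target h.pos_self (by simp [target_grow]) (by simp [fresh])
    (by simp only [delta, if_true]; push_cast; omega)
  neg_self := atLeast_act_of_target h.neg_self (by simp [target_grow]) (by simp [fresh])
    (by simp only [delta, if_true]; push_cast; omega)
  cap := atLeast_act_of_target h.cap (by simp [target_grow]) (by simp [fresh]) (by simp [delta])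
  spare := atLeast_act_of_target h.spare (by simp [target_grow]) (by simp [fresh])
    (by simp only [delta]; push_cast; omega)

/-- If a test ends after exactly `N` growing steps, no precision is lost. -/
theorem LowerTest.close (h : LowerTest i N N c r) (hc : c i = 0) :
    Lower (N + N) c (act r .close) where
  base := atMost_act_base (by simpa [delta] using h.base)
  err := by
    refine atLeast_act (fun x hx => ?_) (by simp [fresh])
    cases x with
    | err => simpa [delta] using h.err
    | cap => simpa [delta, two_mul] using h.cap
    | _ => simp [target] at hx
  pos j := by
    refine atLeast_act_of_target (s := N + N + c j) ?_ (fun x => ?_) (by simp [fresh])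
      (by simp [delta])
    · by_cases hj : j = i
      · subst hj
        simpa [hc, two_mul] using h.pos_self
      · exact h.pos j hj
    · cases x <;> simp [target]
  neg j := by
    refine atLeast_act_of_target (s := N + N - c j) ?_ (fun x => ?_) (by simp [fresh])
      (by simp [delta])
    · by_cases hj : j = i
      · subst hj
        simpa [hc, two_mul] using h.neg_self
      · exact h.neg j hj
    · cases x <;> simp [target]
  cap := by
    refine atLeast_act (fun x hx => ?_) (by simp [fresh])
    cases x with
    | spare => exact h.spare.mono (by simp only [delta]; push_cast; omega)
    | _ => simp [target] at hx

end Complete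

theorem Lower.zero {N : ℤ} {c : ℕ → ℤ} {r : Reg m → ℕ∞} {i : ℕ} (hi : i ≤ m)
    (hc : c i = 0) (h : Lower N c r) :
    ∃ w ∈ (CounterProg.zero i).language m, ∃ N', Lower N' c (w.foldl act r) := by
  have hc' : c (Fin.ofNat (m + 1) i) = 0 := by rwa [val_ofNat_of_le hi]
  obtain ⟨n, rfl⟩ := Int.eq_ofNat_of_zero_le h.base.1
  have h2 : ∀ k : ℕ, LowerTest (Fin.ofNat (m + 1) i) n k c
      ((List.replicate k (.grow (Fin.ofNat (m + 1) i))).foldl act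
        (act r (.test (Fin.ofNat (m + 1) i)))) := by
    intro k
    induction k with
    | zero => exact h.test hc'
    | succ k ih =>
      rw [act_foldl_replicate]
      exact_mod_cast ih.grow
  refine ⟨_, mem_language_zero.2 ⟨n, rfl⟩, n + n, ?_⟩
  rw [List.foldl_cons, List.foldl_append]
  exact (h2 n).close hc'

/-- Each run of `P` is described by a word of its language that preserves `base ≤ err`. -/
theorem Lower.exists_word {P : CounterProg} (hP : P.bound ≤ m) {N : ℤ} {c c' : ℕ → ℤ}
    {r : Reg m → ℕ∞} (h : Lower N c r) (hr : P.rel c c') :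
    ∃ w ∈ P.language m, ∃ N', Lower N' c' (w.foldl act r) := by
  induction P generalizing N c c' r with
  | inc i =>
    obtain rfl := hr
    have := h.inc (i := Fin.ofNat (m + 1) i)
    rw [val_ofNat_of_le (i := i) hP] at this
    exact ⟨_, rfl, _, this⟩
  | dec i =>
    obtain rfl := hr
    have := h.dec (i := Fin.ofNat (m + 1) i)
    rw [val_ofNat_of_le (i := i) hP] at this
    exact ⟨_, rfl, _, this⟩
  | zero i =>
    obtain ⟨h0, rfl⟩ := hr
    exact h.zero hP h0
  | seq P Q ihP ihQ =>
    obtain ⟨t, hr1, hr2⟩ := hr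
    obtain ⟨u, hu, N1, h1⟩ := ihP ((le_max_left _ _).trans hP) h hr1
    obtain ⟨v, hv, N2, h2⟩ := ihQ ((le_max_right _ _).trans hP) h1 hr2
    exact ⟨u ++ v, ⟨u, hu, v, hv, rfl⟩, N2, by rwa [List.foldl_append]⟩
  | alt P Q ihP ihQ =>
    rcases hr with hr | hr
    · obtain ⟨w, hw, h'⟩ := ihP ((le_max_left _ _).trans hP) h hr
      exact ⟨w, .inl hw, h'⟩
    · obtain ⟨w, hw, h'⟩ := ihQ ((le_max_right _ _).trans hP) h hr
      exact ⟨w, .inr hw, h'⟩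
  | star P ih =>
    change Relation.ReflTransGen P.rel c c' at hr
    induction hr with
    | refl => exact ⟨[], Language.nil_mem_kstar _, N, h⟩
    | tail _ hr ihr =>
      obtain ⟨u, hu, N1, h1⟩ := ihr
      obtain ⟨v, hv, N2, h2⟩ := ih hP h1 hr
      refine ⟨u ++ v, ?_, N2, by rwa [List.foldl_append]⟩
      change u ++ v ∈ KStar.kstar (P.language m)
      rw [← Language.one_add_kstar_mul_self_eq_kstar]
      exact .inr ⟨u, hu, v, hv, rfl⟩

/-- The initial register contents: counter `0` is `v`, the other counters are zero, and `base` is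
large enough to represent these values. -/
def initReg (v : ℕ) : Reg m → ℕ
  | .base => v
  | .err => v
  | .pos j => if j = 0 then 2 * v else v
  | .neg j => if j = 0 then 0 else v
  | .cap => 2 * v
  | .spare => 0

/-- The initial counter values. -/
def initState (v : ℕ) : ℕ → ℤ := Function.update 0 0 v

theorem exists_word_iff {P : CounterProg} (hP : P.bound ≤ m) (v : ℕ) :
    (∃ w ∈ P.language m, w.foldl act (fun x => (initReg v x : ℕ∞)) .base ≤
        w.foldl act (fun x => (initReg v x : ℕ∞)) .err) ↔
      ∃ c, P.rel (initState v) c := by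
  have hpos : ∀ j : Fin (m + 1), (initReg v (.pos j) : ℤ) = v + initState v j := by
    intro j
    simp only [initReg, initState, Function.update_apply, Fin.val_eq_zero_iff]
    split_ifs <;> push_cast <;> simp [two_mul]
  have hneg : ∀ j : Fin (m + 1), (initReg v (.neg j) : ℤ) = v - initState v j := by
    intro j
    simp only [initReg, initState, Function.update_apply, Fin.val_eq_zero_iff]
    split_ifs <;> push_cast <;> simp
  have hcap : (initReg v (.cap : Reg m) : ℤ) = 2 * v := by simp [initReg]
  have most : ∀ n : ℕ, AtMost n n := fun n => ⟨by simp, by simp⟩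
  have least : ∀ n : ℕ, AtLeast n n := fun n => by simp [AtLeast]
  constructor
  · rintro ⟨w, hw, he⟩
    have hU : Upper v (initState v) (fun x : Reg m => (initReg v x : ℕ∞)) :=
      ⟨least v, fun j => hpos j ▸ most _, fun j => hneg j ▸ most _, hcap ▸ most _⟩
    obtain ⟨_, c, hr, -⟩ := hU.exists_rel hP hw he
    exact ⟨c, hr⟩
  · rintro ⟨c, hr⟩
    have hL : Lower v (initState v) (fun x : Reg m => (initReg v x : ℕ∞)) :=
      ⟨most v, least v, fun j => hpos j ▸ least _, fun j => hneg j ▸ least _, hcap ▸ least _⟩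
    obtain ⟨w, hw, _, h⟩ := hL.exists_word hP hr
    exact ⟨w, hw, h.base.2.trans h.err⟩

end CounterProg

/-! ### Arithmetic with counter programs -/

namespace CounterProg

open Function

variable {s s' : ℕ → ℤ} {i j p t : ℕ}

theorem rel_inc : (inc i).rel s s' ↔ s' = update s i (s i + 1) := Iff.rfl

theorem rel_dec : (dec i).rel s s' ↔ s' = update s i (s i - 1) := Iff.rfl

theorem rel_zero : (zero i).rel s s' ↔ s i = 0 ∧ s' = s := Iff.rfl

theorem rel_seq {P Q : CounterProg} : (seq P Q).rel s s' ↔ ∃ t, P.rel s t ∧ Q.rel t s' := Iff.rfl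

theorem rel_alt {P Q : CounterProg} : (alt P Q).rel s s' ↔ P.rel s s' ∨ Q.rel s s' := Iff.rfl

/-- If `T k` is the set of the states after `k` iterations of `P`, the states after `star P` are
those in some `T k`. -/
theorem rel_star_of_sets {P : CounterProg} (T : ℕ → Set (ℕ → ℤ))
    (hT : ∀ k s', s' ∈ T (k + 1) ↔ ∃ s ∈ T k, P.rel s s') (s' : ℕ → ℤ) :
    (∃ s ∈ T 0, (star P).rel s s') ↔ ∃ k, s' ∈ T k := by
  constructor
  · rintro ⟨s, hs, h⟩
    change Relation.ReflTransGen P.rel s s' at h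
    induction h with
    | refl => exact ⟨0, hs⟩
    | tail _ h ih =>
      obtain ⟨k, hk⟩ := ih
      exact ⟨k + 1, (hT _ _).2 ⟨_, hk, h⟩⟩
  · rintro ⟨k, hk⟩
    induction k generalizing s' with
    | zero => exact ⟨s', hk, .refl⟩
    | succ k ih =>
      obtain ⟨t, ht, h⟩ := (hT _ _).1 hk
      obtain ⟨s, hs, h'⟩ := ih t ht
      exact ⟨s, hs, .tail h' h⟩

theorem rel_star_of_seq {P : CounterProg} (S : ℕ → ℕ → ℤ)
    (hS : ∀ k s', P.rel (S k) s' ↔ s' = S (k + 1)) (s' : ℕ → ℤ) :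
    (star P).rel (S 0) s' ↔ ∃ k, s' = S k := by
  simpa using rel_star_of_sets (fun k => {S k}) (by simp [hS]) s'

/-- Repeat `P` until counter `i` is zero. The body `P` is meant to decrease counter `i`. -/
def loop (i : ℕ) (P : CounterProg) : CounterProg := seq (star P) (zero i)

/-- If `T k` is the set of the states after `k` iterations of `P`, the states after `loop i P` are
those in `T n`, where `n` is the initial value of counter `i`. Runs that continue beyond `n`
iterations make counter `i` negative and therefore never leave the loop. -/
theorem rel_loop_of_sets {P : CounterProg} (n : ℕ) (T : ℕ → Set (ℕ → ℤ))
    (hT : ∀ k s', s' ∈ T (k + 1) ↔ ∃ s ∈ T k, P.rel s s')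
    (hi : ∀ k, ∀ s ∈ T k, s i = n - k) (s' : ℕ → ℤ) :
    (∃ s ∈ T 0, (loop i P).rel s s') ↔ s' ∈ T n := by
  have h := rel_star_of_sets T hT
  constructor
  · rintro ⟨s, hs, u, hu, h0, rfl⟩
    obtain ⟨k, hk⟩ := (h _).1 ⟨s, hs, hu⟩
    obtain rfl : k = n := by
      have := hi k _ hk
      omega
    exact hk
  · intro hs
    obtain ⟨s, hs0, hu⟩ := (h _).2 ⟨n, hs⟩
    exact ⟨s, hs0, s', hu, by simpa using hi n _ hs, rfl⟩

/-- A loop whose body acts deterministically. It blocks if counter `i` is negative at the start. -/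
theorem rel_loop_of_seq {P : CounterProg} (S : ℕ → ℕ → ℤ)
    (hS : ∀ k s', P.rel (S k) s' ↔ s' = S (k + 1)) (hi : ∀ k, S k i = S 0 i - k) (s' : ℕ → ℤ) :
    (loop i P).rel (S 0) s' ↔ 0 ≤ S 0 i ∧ s' = S (S 0 i).toNat := by
  rw [loop, rel_seq]
  simp only [rel_star_of_seq S hS, rel_zero]
  constructor
  · rintro ⟨_, ⟨k, rfl⟩, h0, rfl⟩
    rw [hi] at h0
    refine ⟨by omega, ?_⟩
    congr
    omega
  · rintro ⟨h0, rfl⟩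
    exact ⟨_, ⟨_, rfl⟩, by rw [hi]; omega, rfl⟩

/-- Set counter `i` to zero, if it is not negative. -/
def clear (i : ℕ) : CounterProg := loop i (dec i)

theorem rel_clear : (clear i).rel s s' ↔ 0 ≤ s i ∧ s' = update s i 0 := by
  have := rel_loop_of_seq (i := i) (P := dec i) (fun k => update s i (s i - k))
    (by simp [rel_dec, sub_sub]) (by simp) s'
  simp only [Nat.cast_zero, sub_zero, update_eq_self] at this
  rw [clear, this]
  refine and_congr_right fun h => ?_
  rw [Int.toNat_of_nonneg h, sub_self]

/-- Add counter `i` to counter `j` and set counter `i` to zero. -/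
def move (i j : ℕ) : CounterProg := loop i (seq (dec i) (inc j))

theorem rel_move (hij : i ≠ j) :
    (move i j).rel s s' ↔ 0 ≤ s i ∧ s' = update (update s i 0) j (s j + s i) := by
  have := rel_loop_of_seq (i := i) (P := seq (dec i) (inc j))
    (fun k => update (update s i (s i - k)) j (s j + k)) ?_ (by simp [hij]) s'
  · simp only [Nat.cast_zero, sub_zero, add_zero, update_eq_self] at this
    rw [move, this]
    refine and_congr_right fun h => ?_
    rw [Int.toNat_of_nonneg h, sub_self]
  · intro k s'
    simp only [rel_seq, rel_dec, rel_inc, exists_eq_left]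
    refine Eq.congr_right (funext fun x => ?_)
    simp only [update_apply]
    grind

/-- Add counter `i` to counters `j` and `t` and set counter `i` to zero. -/
def moveTwo (i j t : ℕ) : CounterProg := loop i (seq (dec i) (seq (inc j) (inc t)))

theorem rel_moveTwo (hij : i ≠ j) (hit : i ≠ t) (hjt : j ≠ t) :
    (moveTwo i j t).rel s s' ↔
      0 ≤ s i ∧ s' = update (update (update s i 0) j (s j + s i)) t (s t + s i) := by
  have := rel_loop_of_seq (i := i) (P := seq (dec i) (seq (inc j) (inc t)))
    (fun k => update (update (update s i (s i - k)) j (s j + k)) t (s t + k)) ?_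
    (by simp [hij, hit]) s'
  · simp only [Nat.cast_zero, sub_zero, add_zero, update_eq_self] at this
    rw [moveTwo, this]
    refine and_congr_right fun h => ?_
    rw [Int.toNat_of_nonneg h, sub_self]
  · intro k s'
    simp only [rel_seq, rel_dec, rel_inc, exists_eq_left]
    refine Eq.congr_right (funext fun x => ?_)
    simp only [update_apply]
    grind

/-- Subtract counter `i` from counter `j` and set counter `i` to zero. -/
def sub (i j : ℕ) : CounterProg := loop i (seq (dec i) (dec j))

theorem rel_sub (hij : i ≠ j) :
    (sub i j).rel s s' ↔ 0 ≤ s i ∧ s' = update (update s i 0) j (s j - s i) := by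
  have := rel_loop_of_seq (i := i) (P := seq (dec i) (dec j))
    (fun k => update (update s i (s i - k)) j (s j - k)) ?_ (by simp [hij]) s'
  · simp only [Nat.cast_zero, sub_zero, update_eq_self] at this
    rw [sub, this]
    refine and_congr_right fun h => ?_
    rw [Int.toNat_of_nonneg h, sub_self]
  · intro k s'
    simp only [rel_seq, rel_dec, exists_eq_left]
    refine Eq.congr_right (funext fun x => ?_)
    simp only [update_apply]
    grind

/-- Add counter `i` to counter `j`, with `t` as an auxiliary counter. -/
def copy (i j t : ℕ) : CounterProg := seq (moveTwo i j t) (move t i)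

theorem rel_copy (hij : i ≠ j) (hit : i ≠ t) (hjt : j ≠ t) (ht : s t = 0) :
    (copy i j t).rel s s' ↔ 0 ≤ s i ∧ s' = update s j (s j + s i) := by
  simp only [copy, rel_seq, rel_moveTwo hij hit hjt, rel_move hit.symm, and_assoc,
    exists_and_left, exists_eq_left]
  refine and_congr_right fun h => ?_
  have h1 : (0 : ℤ) ≤ s t + s i := by omega
  simp only [update_self, h1, true_and]
  refine Eq.congr_right (funext fun x => ?_)
  simp only [update_apply]
  grind

/-- Add the product of counters `i` and `j` to counter `p` and set counter `i` to zero, with `t` as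
an auxiliary counter. -/
def mulAdd (i j p t : ℕ) : CounterProg := loop i (seq (dec i) (copy j p t))

theorem rel_mulAdd (hij : i ≠ j) (hip : i ≠ p) (hit : i ≠ t) (hjp : j ≠ p) (hjt : j ≠ t)
    (hpt : p ≠ t) (ht : s t = 0) (hj : 0 ≤ s j) :
    (mulAdd i j p t).rel s s' ↔ 0 ≤ s i ∧ s' = update (update s i 0) p (s p + s i * s j) := by
  have := rel_loop_of_seq (i := i) (P := seq (dec i) (copy j p t))
    (fun k => update (update s i (s i - k)) p (s p + k * s j)) ?_ (by simp [hip]) s'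
  · simp only [Nat.cast_zero, sub_zero, zero_mul, add_zero, update_eq_self] at this
    rw [mulAdd, this]
    refine and_congr_right fun h => ?_
    rw [Int.toNat_of_nonneg h, sub_self]
  · intro k s'
    have h1 : update (update (update s i (s i - k)) p (s p + k * s j)) i
        (update (update s i (s i - k)) p (s p + k * s j) i - 1) t = 0 := by
      simp only [update_apply]
      grind
    simp only [rel_seq, rel_dec, exists_eq_left, rel_copy hjp hjt hpt h1]
    have h2 : (update (update (update s i (s i - k)) p (s p + k * s j)) i
        (update (update s i (s i - k)) p (s p + k * s j) i - 1)) j = s j := by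
      simp only [update_apply]
      grind
    rw [h2]
    simp only [hj, true_and]
    refine Eq.congr_right ?_
    ext x
    have h3 : ((k + 1 : ℕ) : ℤ) * s j = k * s j + s j := by push_cast; ring
    rw [h3]
    clear h1 h2
    simp only [update_apply]
    grind

/-- Add an arbitrary natural number to counter `i`. -/
def guess (i : ℕ) : CounterProg := star (inc i)

theorem rel_guess : (guess i).rel s s' ↔ ∃ n : ℕ, s' = update s i (s i + n) := by
  have := rel_star_of_seq (P := inc i) (fun k => update s i (s i + k))
    (by simp [rel_inc, add_assoc]) s'
  simpa [guess] using this

/-- Replace the contents of counters `b` and `b + 1` by their code `Nat.pair` in counter `b`. The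
two branches correspond to the two cases in the definition of `Nat.pair`. -/
def pairing (b : ℕ) : CounterProg :=
  alt
    (seq (copy b (b + 2) (b + 3)) (seq (copy (b + 1) (b + 4) (b + 3))
      (seq (mulAdd (b + 4) (b + 1) (b + 2) (b + 3)) (seq (sub b (b + 1))
        (seq (dec (b + 1)) (seq (clear (b + 1)) (move (b + 2) b)))))))
    (seq (copy b (b + 2) (b + 3)) (seq (copy (b + 1) (b + 2) (b + 3))
      (seq (copy b (b + 4) (b + 3)) (seq (mulAdd (b + 4) b (b + 2) (b + 3))
        (seq (sub (b + 1) b) (seq (clear b) (move (b + 2) b)))))))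

theorem rel_pairing {b : ℕ} (hb : 0 ≤ s b) (hb1 : 0 ≤ s (b + 1)) (h2 : s (b + 2) = 0)
    (h3 : s (b + 3) = 0) (h4 : s (b + 4) = 0) :
    (pairing b).rel s s' ↔
      s' = update (update s b (Nat.pair (s b).toNat (s (b + 1)).toNat)) (b + 1) 0 := by
  obtain ⟨x, h0⟩ := Int.eq_ofNat_of_zero_le hb
  obtain ⟨y, h1⟩ := Int.eq_ofNat_of_zero_le hb1
  rw [h0, h1, Int.toNat_natCast, Int.toNat_natCast]
  simp [pairing, rel_alt, rel_seq, rel_copy, rel_mulAdd, rel_sub, rel_clear, rel_move, rel_dec,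
    and_assoc, h0, h1, h2, h3, h4]
  by_cases hxy : x < y
  · have e1 : (1 : ℤ) ≤ y - x := by omega
    have e2 : ¬ y ≤ x := by omega
    have e3 : (0 : ℤ) ≤ x + y * y := by positivity
    have e4 : (x + y * y : ℤ) = Nat.pair x y := by
      rw [Nat.pair, if_pos hxy]
      push_cast
      ring
    simp only [e1, e2, e3, true_and, false_and, or_false]
    rw [e4]
    refine Eq.congr_right (funext fun z => ?_)
    simp only [update_apply]
    grind
  · have e1 : ¬ (1 : ℤ) ≤ y - x := by omega
    have e2 : y ≤ x := by omega
    have e3 : (0 : ℤ) ≤ x + y + x * x := by positivity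
    have e4 : (x + y + x * x : ℤ) = Nat.pair x y := by
      rw [Nat.pair, if_neg hxy]
      push_cast
      ring
    simp only [e1, e2, e3, true_and, false_and, false_or]
    rw [e4]
    refine Eq.congr_right (funext fun z => ?_)
    simp only [update_apply]
    grind

/-- Replace the content `z` of counter `b` by the two components of `Nat.unpair z`, in counters `b`
and `b + 1`: guess the components and compare their code with `z`. -/
def unpairing (b : ℕ) : CounterProg :=
  seq (guess (b + 1)) (seq (guess (b + 2)) (seq (copy (b + 1) (b + 3) (b + 5))
    (seq (copy (b + 2) (b + 4) (b + 5)) (seq (pairing (b + 3)) (seq (sub (b + 3) b)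
      (seq (zero b) (seq (move (b + 1) b) (move (b + 2) (b + 1)))))))))

theorem rel_unpairing {b z : ℕ} (h0 : s b = z) (h : ∀ j, b < j → s j = 0) :
    (unpairing b).rel s s' ↔
      s' = update (update s b (Nat.unpair z).1) (b + 1) (Nat.unpair z).2 := by
  have h1 : ∀ n, s (b + (n + 1)) = 0 := fun n => h _ (by omega)
  have e1 := h1 0
  have e2 := h1 1
  have e3 := h1 2
  have e4 := h1 3
  have e5 := h1 4
  have e6 := h1 5
  have e7 := h1 6
  simp only [Nat.reduceAdd] at e1 e2 e3 e4 e5 e6 e7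
  simp [unpairing, rel_seq, rel_copy, rel_guess, rel_pairing, rel_sub, rel_zero, rel_move,
    and_assoc, add_assoc, h0, e1, e2, e3, e4, e5, e6, e7]
  constructor
  · rintro ⟨m, n, hz, rfl⟩
    obtain rfl : z = Nat.pair m n := by omega
    rw [Nat.unpair_pair]
    funext x
    simp only [update_apply]
    grind
  · rintro rfl
    refine ⟨(Nat.unpair z).1, (Nat.unpair z).2, by rw [Nat.pair_unpair, sub_self], ?_⟩
    rw [Nat.pair_unpair]
    funext x
    simp only [update_apply]
    grind

end CounterProg

/-! ### Counter programs compute the partial recursive functions -/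

namespace CounterProg

open Function

/-- The partial function `f` is computed, in place and for every `b`, by a program that has its
argument and its result in counter `b`, leaves the counters below `b` as they are, and expects and
leaves zeros in the counters above `b`. -/
def Computes (f : ℕ →. ℕ) : Prop :=
  ∀ b, ∃ P : CounterProg, ∀ (s : ℕ → ℤ) (x : ℕ), s b = x → (∀ j, b < j → s j = 0) →
    ∀ s', P.rel s s' ↔ ∃ y ∈ f x, s' = update s b (y : ℤ)

variable {f g : ℕ →. ℕ}

theorem rel_seq_of_eq {P Q : CounterProg} {s u : ℕ → ℤ} (h : ∀ t, P.rel s t ↔ t = u)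
    (s' : ℕ → ℤ) : (seq P Q).rel s s' ↔ Q.rel u s' := by
  simp [rel_seq, h]

theorem rel_seq_of_mem {P Q : CounterProg} {s : ℕ → ℤ} {A : Part ℕ} {u : ℕ → ℕ → ℤ}
    (h : ∀ t, P.rel s t ↔ ∃ y ∈ A, t = u y) (s' : ℕ → ℤ) :
    (seq P Q).rel s s' ↔ ∃ y ∈ A, Q.rel (u y) s' := by
  simp only [rel_seq, h]
  grind

theorem computes_zero : Computes (pure 0) := by
  refine fun b => ⟨clear b, fun s x hx _ s' => ?_⟩
  simp [rel_clear, hx, pure, PFun.pure]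

theorem computes_succ : Computes Nat.succ := by
  refine fun b => ⟨inc b, fun s x hx _ s' => ?_⟩
  simp [rel_inc, hx]

theorem computes_left : Computes ↑fun n : ℕ => n.unpair.1 := by
  refine fun b => ⟨seq (unpairing b) (clear (b + 1)), fun s x hx h s' => ?_⟩
  rw [rel_seq_of_eq fun t => rel_unpairing hx h]
  simp [rel_clear]
  refine Eq.congr_right (funext fun z => ?_)
  simp only [update_apply]
  grind

theorem computes_right : Computes ↑fun n : ℕ => n.unpair.2 := by
  refine fun b => ⟨seq (unpairing b) (seq (clear b) (move (b + 1) b)), fun s x hx h s' => ?_⟩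
  rw [rel_seq_of_eq fun t => rel_unpairing hx h]
  simp [rel_clear, rel_seq, rel_move]
  refine Eq.congr_right (funext fun z => ?_)
  simp only [update_apply]
  grind

theorem Computes.comp (hf : Computes f) (hg : Computes g) : Computes fun n => g n >>= f := by
  intro b
  obtain ⟨P, hP⟩ := hf b
  obtain ⟨Q, hQ⟩ := hg b
  refine ⟨seq Q P, fun s x hx h s' => ?_⟩
  rw [rel_seq_of_mem (hQ s x hx h)]
  have : ∀ y : ℕ, P.rel (update s b (y : ℤ)) s' ↔ ∃ z ∈ f y, s' = update s b (z : ℤ) := by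
    intro y
    rw [hP _ y (by simp) (fun j hj => by rw [update_of_ne hj.ne', h j hj])]
    simp
  simp only [this]
  constructor
  · rintro ⟨y, hy, z, hz, rfl⟩
    exact ⟨z, Part.mem_bind hy hz, rfl⟩
  · rintro ⟨z, hz, rfl⟩
    obtain ⟨y, hy, hz⟩ := Part.mem_bind_iff.1 hz
    exact ⟨y, hy, z, hz, rfl⟩

theorem Computes.pair (hf : Computes f) (hg : Computes g) :
    Computes fun n => Nat.pair <$> f n <*> g n := by
  intro b
  obtain ⟨P, hP⟩ := hf (b + 1)
  obtain ⟨Q, hQ⟩ := hg (b + 1)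
  refine ⟨seq (copy b (b + 1) (b + 2)) (seq P (seq (seq (move b (b + 2)) (seq (move (b + 1) b)
    (move (b + 2) (b + 1)))) (seq Q (pairing b)))), fun s x hx h s' => ?_⟩
  have e1 := h (b + 1) (by omega)
  have e2 := h (b + 2) (by omega)
  have e3 := h (b + 3) (by omega)
  have e4 := h (b + 4) (by omega)
  have h1 : ∀ t, (copy b (b + 1) (b + 2)).rel s t ↔ t = update s (b + 1) (x : ℤ) := by
    simp [rel_copy, hx, e1, e2]
  have h2 : ∀ t, P.rel (update s (b + 1) (x : ℤ)) t ↔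
      ∃ y ∈ f x, t = update s (b + 1) (y : ℤ) := by
    intro t
    rw [hP _ x (by simp) (fun j hj => by rw [update_of_ne hj.ne', h j (by omega)])]
    simp
  have h3 : ∀ (y : ℕ) t, (seq (move b (b + 2)) (seq (move (b + 1) b)
      (move (b + 2) (b + 1)))).rel (update s (b + 1) (y : ℤ)) t ↔
        t = update (update s b (y : ℤ)) (b + 1) (x : ℤ) := by
    intro y t
    simp [rel_seq, rel_move, hx, e2]
    refine Eq.congr_right (funext fun z => ?_)
    simp only [update_apply]
    grind
  have h4 : ∀ (y : ℕ) t, Q.rel (update (update s b (y : ℤ)) (b + 1) (x : ℤ)) t ↔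
      ∃ z ∈ g x, t = update (update s b (y : ℤ)) (b + 1) (z : ℤ) := by
    intro y t
    rw [hQ _ x (by simp) (fun j hj => by
      rw [update_of_ne hj.ne', update_of_ne (by omega), h j (by omega)])]
    simp
  have h5 : ∀ (y z : ℕ), (pairing b).rel (update (update s b (y : ℤ)) (b + 1) (z : ℤ)) s' ↔
      s' = update s b (Nat.pair y z : ℤ) := by
    intro y z
    rw [rel_pairing (by simp) (by simp) (by simp [e2]) (by simp [e3]) (by simp [e4])]
    refine Eq.congr_right (funext fun z => ?_)
    simp [update_apply]
    grind
  rw [rel_seq_of_eq h1, rel_seq_of_mem h2]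
  simp only [rel_seq_of_eq (h3 _), rel_seq_of_mem (h4 _), h5]
  simp [Seq.seq]

/-- The state `s` with the values `a, n, y, v` in the counters `b, …, b + 3`. -/
def frame (s : ℕ → ℤ) (b : ℕ) (a n y v : ℤ) : ℕ → ℤ :=
  update (update (update (update s b a) (b + 1) n) (b + 2) y) (b + 3) v

theorem frame_above {s : ℕ → ℤ} {b : ℕ} (h : ∀ j, b < j → s j = 0) (a n y v : ℤ) {j : ℕ}
    (hj : b + 3 < j) : frame s b a n y v j = 0 := by
  have := h j (by omega)
  simp only [frame, update_apply]
  grind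

theorem update_frame (s : ℕ → ℤ) (b : ℕ) (a n y v w : ℤ) :
    update (frame s b a n y v) (b + 3) w = frame s b a n y w := by
  simp [frame]

/-- With the values `a, n, y, v` in the counters `b, …, b + 3`, decrease `n` and replace `v` by
`Nat.pair a (Nat.pair y v)`. -/
def precArgument (b : ℕ) : CounterProg :=
  seq (dec (b + 1)) (seq (move (b + 3) (b + 4)) (seq (copy (b + 2) (b + 3) (b + 5))
    (seq (pairing (b + 3)) (seq (move (b + 3) (b + 4)) (seq (copy b (b + 3) (b + 5))
      (pairing (b + 3)))))))

theorem rel_precArgument {s s' : ℕ → ℤ} {b : ℕ} (h : ∀ j, b < j → s j = 0) (a y v : ℕ) (n : ℤ) :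
    (precArgument b).rel (frame s b a n y v) s' ↔
      s' = frame s b a (n - 1) y (Nat.pair a (Nat.pair y v) : ℕ) := by
  have e4 := h (b + 4) (by omega)
  have e5 := h (b + 5) (by omega)
  have e6 := h (b + 6) (by omega)
  have e7 := h (b + 7) (by omega)
  simp [precArgument, frame, rel_seq, rel_dec, rel_move, rel_copy, rel_pairing, add_assoc,
    e4, e5, e6, e7]
  refine Eq.congr_right (funext fun z => ?_)
  simp only [update_apply]
  grind

theorem Computes.prec (hf : Computes f) (hg : Computes g) :
    Computes (Nat.unpaired fun a n => n.rec (f a) fun y IH => do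
      let i ← IH
      g (Nat.pair a (Nat.pair y i))) := by
  intro b
  obtain ⟨P, hP⟩ := hf (b + 3)
  obtain ⟨Q, hQ⟩ := hg (b + 3)
  let B : CounterProg := seq (precArgument b) (seq Q (inc (b + 2)))
  refine ⟨seq (unpairing b) (seq (copy b (b + 3) (b + 4)) (seq P (seq (loop (b + 1) B)
    (seq (clear b) (seq (clear (b + 2)) (move (b + 3) b)))))), fun s x hx h s' => ?_⟩
  have e1 := h (b + 1) (by omega)
  have e2 := h (b + 2) (by omega)
  have e3 := h (b + 3) (by omega)
  have e4 := h (b + 4) (by omega)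
  obtain ⟨a, n, hxa⟩ : ∃ a n, Nat.unpair x = (a, n) := ⟨_, _, rfl⟩
  have h1 : ∀ t, (unpairing b).rel s t ↔ t = update (update s b (a : ℤ)) (b + 1) (n : ℤ) := by
    intro t
    rw [rel_unpairing hx h, hxa]
  have h2 : ∀ t, (copy b (b + 3) (b + 4)).rel (update (update s b (a : ℤ)) (b + 1) (n : ℤ)) t ↔
      t = frame s b a n 0 a := by
    intro t
    simp [rel_copy, e3, e4, frame]
    refine Eq.congr_right (funext fun z => ?_)
    simp only [update_apply]
    grind
  have h3 : ∀ t, P.rel (frame s b a n 0 a) t ↔ ∃ v ∈ f a, t = frame s b a n 0 (v : ℤ) := by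
    intro t
    rw [hP _ a (by simp [frame]) (fun j hj => frame_above h _ _ _ _ hj)]
    simp only [update_frame]
  have hB : ∀ (y v : ℕ) (m : ℤ) t, B.rel (frame s b a m y v) t ↔
      ∃ w ∈ g (Nat.pair a (Nat.pair y v)), t = frame s b a (m - 1) (y + 1 : ℕ) (w : ℤ) := by
    intro y v m t
    rw [rel_seq_of_eq fun t => rel_precArgument h a y v m,
      rel_seq_of_mem (hQ _ (Nat.pair a (Nat.pair y v)) (by simp [frame])
        (fun j hj => frame_above h _ _ _ _ hj))]
    refine exists_congr fun w => and_congr_right fun _ => ?_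
    rw [update_frame, rel_inc]
    refine Eq.congr_right (funext fun z => ?_)
    simp only [frame, update_apply]
    grind
  have h5 : ∀ v : ℕ, (seq (clear b) (seq (clear (b + 2)) (move (b + 3) b))).rel
      (frame s b a 0 n v) s' ↔ s' = update s b (v : ℤ) := by
    intro v
    simp [rel_seq, rel_clear, rel_move, frame]
    refine Eq.congr_right (funext fun z => ?_)
    simp only [update_apply]
    grind
  -- the possible values of the recursion after `k` steps
  let A : ℕ → Part ℕ := fun k => k.rec (f a) fun y IH => do
      let i ← IH
      g (Nat.pair a (Nat.pair y i))
  have h4 := rel_loop_of_sets (P := B) (i := b + 1) n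
    (fun k => {t | ∃ v ∈ A k, t = frame s b a (n - k) k (v : ℤ)}) (by
      intro k t
      have hA : A (k + 1) = (A k).bind fun i => g (Nat.pair a (Nat.pair k i)) := rfl
      have e : (n : ℤ) - k - 1 = n - (k + 1 : ℕ) := by push_cast; ring
      simp only [Set.mem_ofPred_eq, hA, Part.mem_bind_iff]
      constructor
      · rintro ⟨w, ⟨v, hv, hw⟩, rfl⟩
        exact ⟨_, ⟨v, hv, rfl⟩, (hB k v _ _).2 ⟨w, hw, by rw [e]⟩⟩
      · rintro ⟨_, ⟨v, hv, rfl⟩, ht⟩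
        obtain ⟨w, hw, rfl⟩ := (hB k v _ _).1 ht
        exact ⟨w, ⟨v, hv, hw⟩, by rw [e]⟩) (by
      rintro k _ ⟨v, -, rfl⟩
      simp [frame])
  rw [rel_seq_of_eq h1, rel_seq_of_eq h2, rel_seq_of_mem h3]
  have hA : Nat.unpaired (fun a n => n.rec (f a) fun y IH => do
      let i ← IH
      g (Nat.pair a (Nat.pair y i))) x = A n := by
    simp only [Nat.unpaired, hxa]
    rfl
  rw [hA]
  constructor
  · rintro ⟨v, hv, t, ht, hs'⟩
    obtain ⟨w, hw, rfl⟩ := (h4 t).1 ⟨_, ⟨v, hv, rfl⟩, by simpa using ht⟩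
    rw [sub_self, h5] at hs'
    exact ⟨w, hw, hs'⟩
  · rintro ⟨w, hw, rfl⟩
    obtain ⟨_, ⟨v, hv, rfl⟩, ht⟩ := (h4 (frame s b a 0 n w)).2 ⟨w, hw, by rw [sub_self]⟩
    exact ⟨v, hv, _, by simpa using ht, (h5 w).2 rfl⟩

/-- With `a, k, 0` in the counters `b, b + 1, b + 2`, replace the last one by `Nat.pair a k`. -/
def rfindArgument (b : ℕ) : CounterProg :=
  seq (copy b (b + 2) (b + 4)) (seq (copy (b + 1) (b + 3) (b + 4)) (pairing (b + 2)))

theorem Computes.rfind (hf : Computes f) :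
    Computes fun a => Nat.rfind fun n => (fun m => m = 0) <$> f (Nat.pair a n) := by
  intro b
  obtain ⟨P, hP⟩ := hf (b + 2)
  let B : CounterProg := seq (rfindArgument b) (seq P (seq (dec (b + 2)) (seq (clear (b + 2))
    (inc (b + 1)))))
  refine ⟨seq (star B) (seq (rfindArgument b) (seq P (seq (zero (b + 2)) (seq (clear b)
    (move (b + 1) b))))), fun s x hx h s' => ?_⟩
  have e1 := h (b + 1) (by omega)
  have e2 := h (b + 2) (by omega)
  have e3 := h (b + 3) (by omega)
  have e4 := h (b + 4) (by omega)
  have e5 := h (b + 5) (by omega)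
  have e6 := h (b + 6) (by omega)
  have h1 : ∀ (k : ℕ) t, (rfindArgument b).rel (update s (b + 1) (k : ℤ)) t ↔
      t = update (update s (b + 1) (k : ℤ)) (b + 2) (Nat.pair x k : ℕ) := by
    intro k t
    simp [rfindArgument, rel_seq, rel_copy, rel_pairing, add_assoc, hx, e2, e3, e4, e5, e6]
    refine Eq.congr_right (funext fun z => ?_)
    simp only [update_apply]
    grind
  have h2 : ∀ (k : ℕ) t, P.rel (update (update s (b + 1) (k : ℤ)) (b + 2) (Nat.pair x k : ℕ)) t ↔
      ∃ y ∈ f (Nat.pair x k), t = update (update s (b + 1) (k : ℤ)) (b + 2) (y : ℤ) := by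
    intro k t
    rw [hP _ (Nat.pair x k) (by simp) (fun j hj => by
      rw [update_of_ne hj.ne', update_of_ne (by omega), h j (by omega)])]
    simp
  have hB : ∀ (k : ℕ) t, B.rel (update s (b + 1) (k : ℤ)) t ↔
      (∃ y ∈ f (Nat.pair x k), y ≠ 0) ∧ t = update s (b + 1) ((k + 1 : ℕ) : ℤ) := by
    intro k t
    rw [rel_seq_of_eq (h1 k), rel_seq_of_mem (h2 k), ← exists_and_right]
    refine exists_congr fun y => ?_
    rw [and_assoc]
    refine and_congr_right fun _ => ?_
    simp [rel_seq, rel_dec, rel_clear, rel_inc]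
    refine and_congr (by omega) (Eq.congr_right (funext fun z => ?_))
    simp only [update_apply]
    grind
  have h3 := rel_star_of_sets (P := B)
    (fun k => {t | (∀ j < k, ∃ y ∈ f (Nat.pair x j), y ≠ 0) ∧ t = update s (b + 1) (k : ℤ)}) (by
      intro k t
      simp only [Set.mem_ofPred_eq, Nat.forall_lt_succ_right]
      constructor
      · rintro ⟨⟨hk, hy⟩, rfl⟩
        exact ⟨_, ⟨hk, rfl⟩, (hB _ _).2 ⟨hy, rfl⟩⟩
      · rintro ⟨_, ⟨hk, rfl⟩, ht⟩
        obtain ⟨hy, rfl⟩ := (hB _ _).1 ht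
        exact ⟨⟨hk, hy⟩, rfl⟩)
  have hs : update s (b + 1) 0 = s := by rw [← e1, update_eq_self]
  have h4 : ∀ t, (star B).rel s t ↔ ∃ k : ℕ, (∀ j < k, ∃ y ∈ f (Nat.pair x j), y ≠ 0) ∧
      t = update s (b + 1) (k : ℤ) := by
    intro t
    simpa [hs] using h3 t
  have h5 : ∀ (k y : ℕ), (seq (zero (b + 2)) (seq (clear b) (move (b + 1) b))).rel
      (update (update s (b + 1) (k : ℤ)) (b + 2) (y : ℤ)) s' ↔
        y = 0 ∧ s' = update s b (k : ℤ) := by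
    intro k y
    simp [rel_seq, rel_zero, rel_clear, rel_move, and_assoc, hx]
    rintro rfl
    refine Eq.congr_right (funext fun z => ?_)
    simp only [update_apply]
    grind
  have h6 : ∀ k : ℕ, (seq (rfindArgument b) (seq P (seq (zero (b + 2)) (seq (clear b)
      (move (b + 1) b))))).rel (update s (b + 1) (k : ℤ)) s' ↔
        0 ∈ f (Nat.pair x k) ∧ s' = update s b (k : ℤ) := by
    intro k
    rw [rel_seq_of_eq (h1 k), rel_seq_of_mem (h2 k)]
    simp only [h5]
    grind
  rw [rel_seq]
  simp only [h4]
  constructor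
  · rintro ⟨_, ⟨k, hk, rfl⟩, hs'⟩
    obtain ⟨h0, rfl⟩ := (h6 k).1 hs'
    refine ⟨k, Nat.mem_rfind.2 ⟨by simpa using h0, fun {j} hj => ?_⟩, rfl⟩
    simpa using hk j hj
  · rintro ⟨k, hk, rfl⟩
    obtain ⟨h0, hk⟩ := Nat.mem_rfind.1 hk
    refine ⟨_, ⟨k, fun j hj => ?_, rfl⟩, (h6 k).2 ⟨by simpa using h0, rfl⟩⟩
    simpa using hk hj

theorem computes_of_partrec (hf : Nat.Partrec f) : Computes f := by
  induction hf with
  | zero => exact computes_zero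
  | succ => exact computes_succ
  | left => exact computes_left
  | right => exact computes_right
  | pair _ _ hf hg => exact hf.pair hg
  | comp _ _ hf hg => exact hf.comp hg
  | prec _ _ hf hg => exact hf.prec hg
  | rfind _ hf => exact hf.rfind

end CounterProg

/-! ### The reduction -/

namespace CounterProg

variable {m s : ℕ}

theorem foldl_act_base_ne_top {r : Reg m → ℕ∞} (h : r .base ≠ ⊤) (w : List (Letter m)) :
    w.foldl act r .base ≠ ⊤ := by
  induction w generalizing r with
  | nil => exact h
  | cons a w ih =>
    refine ih ?_
    rw [act_base]
    simpa using h

/-- An enumeration of the letters. -/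
noncomputable def letterEquiv (m : ℕ) : Letter m ≃ Fin (Fintype.card (Letter m)) :=
  Fintype.equivFin _

/-- An enumeration of the registers. -/
noncomputable def regEquiv (m : ℕ) : Reg m ≃ Fin (Fintype.card (Reg m)) :=
  Fintype.equivFin _

/-- The cost register automaton with the updates `act`, controlled by the automaton `M`, with the
initial registers for input `v` and with the output coefficients `out`. -/
noncomputable def machine (M : DFA (Letter m) (Fin s)) (v : ℕ) (out : Reg m → ℕ∞) :
    CRA (Fin (Fintype.card (Letter m))) (Fin s) (Fintype.card (Reg m)) where
  toDFA := M.comap (letterEquiv m).symm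
  init i := (initReg v ((regEquiv m).symm i) : ℕ∞)
  coef _ a i j := weight ((letterEquiv m).symm a) ((regEquiv m).symm i) ((regEquiv m).symm j)
  const _ a i := reset ((letterEquiv m).symm a) ((regEquiv m).symm i)
  outCoef _ i := out ((regEquiv m).symm i)
  outConst _ := ⊤

variable (M : DFA (Letter m) (Fin s)) (v : ℕ) (out : Reg m → ℕ∞)

theorem copyless_machine : (machine M v out).Copyless := by
  refine fun q a i => Set.encard_le_one_iff.2 fun j j' hj hj' => ?_
  have h : ∀ j, (machine M v out).coef q a i j ≠ ⊤ →
      target ((letterEquiv m).symm a) ((regEquiv m).symm i) = (regEquiv m).symm j := by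
    intro j hj
    by_contra hne
    exact hj (if_neg hne)
  exact (regEquiv m).symm.injective ((h j hj).symm.trans (h j' hj'))

theorem run_machine (w : List (Fin (Fintype.card (Letter m)))) :
    (machine M v out).run w = (M.eval (w.map (letterEquiv m).symm), fun i =>
      (w.map (letterEquiv m).symm).foldl act (fun x => (initReg v x : ℕ∞))
        ((regEquiv m).symm i)) := by
  induction w using List.reverseRecOn with
  | nil => rfl
  | append_singleton w a ih =>
    rw [CRA.run, List.foldl_append, List.foldl_cons, List.foldl_nil]
    change (machine M v out).next ((machine M v out).run w) a = _
    rw [ih]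
    simp only [List.map_append, List.map_cons, List.map_nil, List.foldl_append, List.foldl_cons,
      List.foldl_nil, DFA.eval_append_singleton]
    refine Prod.ext rfl (funext fun i => ?_)
    simp only [CRA.next, act, machine]
    rw [← (regEquiv m).symm.iInf_comp]

open Classical in
theorem value_machine (w : List (Fin (Fintype.card (Letter m)))) :
    (machine M v out).value w = if w.map (letterEquiv m).symm ∈ M.accepts then
      ⨅ x, ((w.map (letterEquiv m).symm).foldl act (fun x => (initReg v x : ℕ∞)) x + out x)
    else ⊤ := by
  rw [CRA.value, run_machine, ← (regEquiv m).symm.iInf_comp]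
  simp [machine, DFA.mem_accepts]

/-- Output `err + 1`. -/
def outErr : Reg m → ℕ∞
  | .err => 1
  | _ => ⊤

/-- Output the minimum of `err + 1` and `base`. -/
def outMin : Reg m → ℕ∞
  | .err => 1
  | .base => 0
  | _ => ⊤

theorem iInf_outErr (r : Reg m → ℕ∞) : ⨅ x, (r x + outErr x) = r .err + 1 := by
  refine le_antisymm (iInf_le _ Reg.err) (le_iInf fun x => ?_)
  cases x <;> simp [outErr]

theorem iInf_outMin (r : Reg m → ℕ∞) : ⨅ x, (r x + outMin x) = min (r .err + 1) (r .base) := by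
  refine le_antisymm (le_min (iInf_le _ Reg.err) ((iInf_le _ Reg.base).trans (by simp [outMin])))
    (le_iInf fun x => ?_)
  cases x <;> simp [outMin]

/-- The two machines differ exactly on the words of the language that end with `base ≤ err`. -/
theorem forall_value_eq_iff :
    (∀ w, (machine M v outErr).value w = (machine M v outMin).value w) ↔
      ¬ ∃ w ∈ M.accepts, w.foldl act (fun x => (initReg v x : ℕ∞)) .base ≤
        w.foldl act (fun x => (initReg v x : ℕ∞)) .err := by
  have key : ∀ w : List (Letter m), (w.foldl act (fun x => (initReg v x : ℕ∞)) .err + 1 =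
      min (w.foldl act (fun x => (initReg v x : ℕ∞)) .err + 1)
        (w.foldl act (fun x => (initReg v x : ℕ∞)) .base)) ↔
      ¬ w.foldl act (fun x => (initReg v x : ℕ∞)) .base ≤
        w.foldl act (fun x => (initReg v x : ℕ∞)) .err := by
    intro w
    have hb := foldl_act_base_ne_top (r := fun x : Reg m => (initReg v x : ℕ∞)) (by simp) w
    rw [eq_comm, min_eq_left_iff, not_le]
    by_cases he : w.foldl act (fun x => (initReg v x : ℕ∞)) .err = ⊤
    · simp [he, hb]
    · exact ENat.add_one_le_iff he
  push Not
  constructor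
  · intro h w hw
    have h' := h (w.map (letterEquiv m))
    rw [value_machine, value_machine] at h'
    simp only [List.map_map, Equiv.symm_comp_self, List.map_id, hw, if_true, iInf_outErr,
      iInf_outMin] at h'
    exact not_le.1 ((key w).1 h')
  · intro h w
    rw [value_machine, value_machine]
    split_ifs with hw
    · rw [iInf_outErr, iInf_outMin]
      exact (key _).2 (not_le.2 (h _ hw))
    · rfl

theorem code_machine : (machine M v out).code =
    (Fintype.card (Letter m), s, Fintype.card (Reg m), (M.start : ℕ),
      List.ofFn (fun i => some (initReg v ((regEquiv m).symm i))),
      (machine M 0 out).code.2.2.2.2.2) := by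
  have h : ∀ n : ℕ, CRA.codeENat n = some n := fun n => by simp [CRA.codeENat]
  simp only [← h]
  rfl

theorem primrec_initReg (x : Reg m) : Primrec fun v => initReg v x := by
  have h2 : Primrec fun v : ℕ => 2 * v := Primrec.nat_mul.comp (.const 2) .id
  cases x with
  | base => exact .id
  | err => exact .id
  | pos j =>
    by_cases h : j = 0
    · simpa [initReg, h] using h2
    · exact Primrec.id.of_eq fun v => by simp [initReg, h]
  | neg j =>
    by_cases h : j = 0
    · simpa [initReg, h] using Primrec.const 0
    · exact Primrec.id.of_eq fun v => by simp [initReg, h]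
  | cap => exact h2
  | spare => exact .const 0

/-- Only the initial registers depend on the input, so a machine for it can be computed. -/
theorem computable_code_machine : Computable fun v => (machine M v out).code := by
  refine Primrec.to_comp (.of_eq ?_ fun v => (code_machine M v out).symm)
  exact .pair (.const _) (.pair (.const _) (.pair (.const _) (.pair (.const _) (.pair
    (Primrec.list_ofFn fun i => Primrec.option_some.comp (primrec_initReg _)) (.const _)))))

end CounterProg

/-- There is a single partial recursive function whose domain is not decidable. -/
theorem exists_partrec_not_computablePred_dom :
    ∃ f : ℕ →. ℕ, Nat.Partrec f ∧ ¬ ComputablePred fun n => (f n).Dom := by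
  refine ⟨fun n => (Denumerable.ofNat Nat.Partrec.Code n).eval 0,
    Partrec.nat_iff.1 (Nat.Partrec.Code.eval_part.comp (Computable.ofNat _) (.const 0)),
    fun h => ComputablePred.halting_problem 0 ?_⟩
  obtain ⟨g, hg, h⟩ := ComputablePred.computable_iff.1 h
  refine ComputablePred.computable_iff.2 ⟨fun c => g (Encodable.encode c),
    hg.comp .encode, funext fun c => ?_⟩
  have := congrFun h (Encodable.encode c)
  simpa only [Denumerable.ofNat_encode] using this

open CounterProg in
/-- Equivalence of copyless cost register automata over `(ℕ ∪ {∞}, min, +)` is undecidable: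
no computable function decides, from the descriptions of two such machines over a common
alphabet, whether they compute the same function on words. -/
theorem mainTheorem1 :
    ¬ ∃ f : CRA.Code × CRA.Code → Bool, Computable f ∧
      ∀ (n s s' k k' : ℕ) (C : CRA (Fin n) (Fin s) k) (C' : CRA (Fin n) (Fin s') k'),
        C.Copyless → C'.Copyless →
          (f (C.code, C'.code) = true ↔ ∀ w : List (Fin n), C.value w = C'.value w) := by
  rintro ⟨f, hf, hfC⟩
  obtain ⟨g, hg, hdom⟩ := exists_partrec_not_computablePred_dom
  obtain ⟨P, hP⟩ := computes_of_partrec hg 0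
  obtain ⟨σ, _, M, hM⟩ := P.isRegular_language (m := P.bound)
  let M' := DFA.reindex (Fintype.equivFin σ) M
  have hM' : M'.accepts = P.language P.bound := by rw [DFA.accepts_reindex, hM]
  refine hdom (ComputablePred.computable_iff.2
    ⟨fun v => !f ((machine M' v outErr).code, (machine M' v outMin).code), ?_, ?_⟩)
  · exact Primrec.not.to_comp.comp (hf.comp
      ((computable_code_machine M' outErr).pair (computable_code_machine M' outMin)))
  · funext v
    have h1 := hfC _ _ _ _ _ _ _ (copyless_machine M' v outErr) (copyless_machine M' v outMin)
    rw [forall_value_eq_iff, hM', exists_word_iff le_rfl] at h1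
    have h2 : (∃ c, P.rel (initState v) c) ↔ (g v).Dom := by
      simp only [hP (initState v) v (by simp [initState])
        (fun j hj => by simp [initState, hj.ne']), Part.dom_iff_mem]
      grind
    rw [h2] at h1
    simp [← Bool.not_eq_true, h1]
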